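/- For $k,m\ge 0$ consider relations $P(x_1,\dots,x_k,f_1,\dots,f_m)$ with number variables $x_i\in\mathbb N$ and function variables $f_j:\mathbb N\to\mathbb N$. Such a relation is arithmetical if it is obtained from computable relations between numbers and the relations $f_j(x_a)=x_b$ by Boolean operations and quantification over $\mathbb N$. Let $\Sigma^1_0$ be the class of arithmetical relations; for each $n$, a relation is $\Pi^1_n$ if its complement is $\Sigma^1_n$, it is $\Delta^1_n$ if it is both $\Sigma^1_n$ and $\Pi^1_n$, and it is $\Sigma^1_{n+1}$ if it has the form $\exists g\, Q$ with $g$ ranging over functions $\mathbb N\to\mathbb N$ and $Q$ a $\Pi^1_n$ relation. An equivalence structure is a pair $\langle\mathbb N,S\rangle$ where $S$ is an equivalence relation on $\mathbb N$; it is called $\Sigma^1_n$ (respectively $\Pi^1_n$, $\Delta^1_n$) if the binary relation $S$ is. Two such structures $\langle\mathbb N,S\rangle$ and $\langle\mathbb N,R\rangle$ are isomorphic if there is a bijection $h:\mathbb N\to\mathbb N$ with $x\,S\,y \iff h(x)\,R\,h(y)$ for all $x,y$. **Proposition.** Let $n\ge 1$ be a natural number. (i) There is a $\Sigma^1_n$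 equivalence structure which is not isomorphic to any $\Delta^1_n$ equivalence structure. Likewise, there is a $\Pi^1_n$ equivalence structure which is not isomorphic to any $\Delta^1_n$ equivalence structure. (ii) There is a $\Delta^1_{n+1}$ equivalence structure which is isomorphic neither to any $\Sigma^1_n$ equivalence structure nor to any $\Pi^1_n$ equivalence structure. -/

import Mathlib

/-- A relation in `k` number variables (ranging over `ℕ`) and `m` function variables
(ranging over `ℕ → ℕ`). -/
abbrev ArithRel (k m : ℕ) : Type :=
  (Fin k → ℕ) → (Fin m → ℕ → ℕ) → Prop

/-- The arithmetical relations: those obtained from computable relations between numbers and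
from the graphs `f (x) = y` of the function variables by Boolean operations and quantification
over natural numbers. Function variables occur only as parameters. -/
inductive IsArithmetical {m : ℕ} : {k : ℕ} → ArithRel k m → Prop
  | computable {k : ℕ} (R : (Fin k → ℕ) → Prop) (hR : ComputablePred R) :
      IsArithmetical fun x _ => R x
  | app {k : ℕ} (j : Fin m) (a b : Fin k) :
      IsArithmetical fun x f => f j (x a) = x b
  | compl {k : ℕ} {P : ArithRel k m} (hP : IsArithmetical P) :
      IsArithmetical fun x f => ¬ P x f
  | inter {k : ℕ} {P Q : ArithRel k m} (hP : IsArithmetical P) (hQ : IsArithmetical Q) :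
      IsArithmetical fun x f => P x f ∧ Q x f
  | exNat {k : ℕ} {P : ArithRel (k + 1) m} (hP : IsArithmetical P) :
      IsArithmetical fun x f => ∃ y : ℕ, P (Fin.cons y x) f

/-- `IsSigmaOne n P`: the relation `P` belongs to the level `Σ¹ₙ` of the analytical hierarchy.
`Σ¹₀` consists of the arithmetical relations, and a relation is `Σ¹ₙ₊₁` if it is of the form
`∃ g : ℕ → ℕ, Q` with `Q` in `Π¹ₙ`, that is, with the complement of `Q` in `Σ¹ₙ`. -/
def IsSigmaOne : (n : ℕ) → {k m : ℕ} → ArithRel k m → Prop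
  | 0, _, _, P => IsArithmetical P
  | n + 1, k, m, P => ∃ Q : ArithRel k (m + 1),
      IsSigmaOne n (fun x f => ¬ Q x f) ∧
        ∀ x f, P x f ↔ ∃ g : ℕ → ℕ, Q x (Fin.cons g f)

/-- `Π¹ₙ`: the complement is `Σ¹ₙ`. -/
def IsPiOne (n : ℕ) {k m : ℕ} (P : ArithRel k m) : Prop :=
  IsSigmaOne n fun x f => ¬ P x f

/-- `Δ¹ₙ`: both `Σ¹ₙ` and `Π¹ₙ`. -/
def IsDeltaOne (n : ℕ) {k m : ℕ} (P : ArithRel k m) : Prop :=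
  IsSigmaOne n P ∧ IsPiOne n P

/-- An equivalence structure `⟨ω, S⟩` is given by an equivalence relation `S` on `ℕ`; this is `S`
as a relation in two number variables and no function variables. The complexity of the structure
is that of this relation. -/
def Setoid.toArithRel (S : Setoid ℕ) : ArithRel 2 0 :=
  fun x _ => S.r (x 0) (x 1)

/-- Isomorphism of the equivalence structures `⟨ω, S⟩` and `⟨ω, R⟩`. -/
def Setoid.IsIsomorphic (S R : Setoid ℕ) : Prop :=
  Nonempty (S.r ≃r R.r)

/-! ### Computability of some list and finite tuple operations -/

/-! The invariant is the set of k for which a structure has a class with exactly k + 2 elements.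
Every set A is realised: `blockSetoid A` has this invariant A and inherits upper bounds on the
complexity of A (`blockSetoid_hasClassOfSize`, `blockSetoid_rel`, `blockSetoid_compl`).

Having a class of a given finite size is expressed with number quantifiers only, and these cost
nothing at levels n ≥ 1. So a Δ¹ₙ structure has a Δ¹ₙ invariant, and (i) follows by taking A in Σ¹ₙ
but not Π¹ₙ, and its complement. If the structure is only Σ¹ₙ or only Π¹ₙ, the invariant still has
the form ∃ b (P ∧ ¬Q) with P and Q in Σ¹ₙ. A diagonal set in Δ¹ₙ₊₁ avoids this form
(`exists_not_exists_inter_compl`), which gives (ii).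

Diagonalisation needs universal relations. The arithmetical relations have no arithmetical universal
relation, so the hierarchy is rebuilt as `SigmaClass` over effectively open relations with one
function parameter, where universal relations exist at every level. From level 1 on it agrees with
the analytical hierarchy (`isSigmaOne_iff_sigmaClass`). -/

theorem Computable.list_map {α β σ : Type*} [Primcodable α] [Primcodable β] [Primcodable σ]
    {l : α → List β} {g : α → β → σ} (hl : Computable l) (hg : Computable₂ g) :
    Computable fun a => (l a).map (g a) := by
  -- The mapped list is rebuilt by recursion on the length of a prefix, one entry at a time.
  have h1 : Computable fun a => (Nat.rec [] (fun i acc =>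
      acc ++ (((l a)[i]?).map (g a)).toList) (l a).length : List σ) := by
    refine Computable.nat_rec (h := fun a p => p.2 ++ (((l a)[p.1]?).map (g a)).toList)
      (Computable.list_length.comp hl) (Computable.const []) ?_
    refine Computable.list_append.comp (Computable.snd.comp Computable.snd) ?_
    refine Primrec.optionToList.to_comp.comp ?_
    refine Computable.option_map (Computable.list_getElem?.comp (hl.comp Computable.fst)
      (Computable.fst.comp Computable.snd)) ?_
    exact hg.comp (Computable.fst.comp Computable.fst) Computable.snd
  refine h1.of_eq fun a => ?_
  have h2 : ∀ n ≤ (l a).length, (Nat.rec [] (fun i acc =>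
      acc ++ (((l a)[i]?).map (g a)).toList) n : List σ) = ((l a).take n).map (g a) := by
    intro n
    induction n with
    | zero => simp
    | succ n ih =>
      intro hn
      have ih := ih (by omega)
      have h3 : (l a)[n]? = some (l a)[n] := List.getElem?_eq_getElem (by omega)
      simp only [] at ih ⊢
      rw [ih, h3, List.take_add_one, h3]
      simp only [Option.map_some, Option.toList_some, List.map_append, List.map_cons, List.map_nil]
  rw [h2 _ le_rfl, List.take_length]

theorem Computable.fin_tuple {α σ : Type*} [Primcodable α] [Primcodable σ] {n : ℕ}
    {f : α → Fin n → σ} (hf : ∀ i, Computable fun a => f a i) : Computable f :=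
  (Primrec.vector_get'.to_comp.comp (Computable.vector_ofFn hf)).of_eq fun a => by
    funext i; simp

theorem Computable.fin_apply {α σ : Type*} [Primcodable α] [Primcodable σ] {n : ℕ}
    {f : α → Fin n → σ} (hf : Computable f) (i : Fin n) : Computable fun a => f a i :=
  Computable.fin_app.comp hf (Computable.const i)

theorem Computable.fin_cons {α σ : Type*} [Primcodable α] [Primcodable σ] {n : ℕ}
    {c : α → σ} {f : α → Fin n → σ} (hc : Computable c) (hf : Computable f) :
    Computable fun a => (Fin.cons (c a) (f a) : Fin (n + 1) → σ) :=
  Computable.fin_tuple fun i => by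
    refine Fin.cases ?_ (fun i => ?_) i
    · simpa using hc
    · simpa using hf.fin_apply i

theorem Computable.list_getD {α σ : Type*} [Primcodable α] [Primcodable σ]
    {l : α → List σ} {i : α → ℕ} (hl : Computable l) (hi : Computable i) (d : σ) :
    Computable fun a => (l a).getD (i a) d :=
  (Primrec.list_getD d).to_comp.comp hl hi

theorem Computable.unpair_fst {α : Type*} [Primcodable α] {c : α → ℕ} (hc : Computable c) :
    Computable fun a => (c a).unpair.1 :=
  Computable.fst.comp (Computable.unpair.comp hc)

theorem Computable.unpair_snd {α : Type*} [Primcodable α] {c : α → ℕ} (hc : Computable c) :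
    Computable fun a => (c a).unpair.2 :=
  Computable.snd.comp (Computable.unpair.comp hc)

theorem Computable.natPair {α : Type*} [Primcodable α] {c d : α → ℕ} (hc : Computable c)
    (hd : Computable d) : Computable fun a => Nat.pair (c a) (d a) :=
  Primrec₂.natPair.to_comp.comp hc hd

theorem Computable.ite_pred {α σ : Type*} [Primcodable α] [Primcodable σ] {p : α → Prop}
    [DecidablePred p] {f g : α → σ} (hp : ComputablePred p) (hf : Computable f)
    (hg : Computable g) : Computable fun a => if p a then f a else g a :=
  (Computable.cond hp.decide hf hg).of_eq fun a => by by_cases h : p a <;> simp [h]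

theorem Computable.evaln {α : Type*} [Primcodable α] {k : α → ℕ} {c : α → Nat.Partrec.Code}
    {x : α → ℕ} (hk : Computable k) (hc : Computable c) (hx : Computable x) :
    Computable fun a => Nat.Partrec.Code.evaln (k a) (c a) (x a) :=
  Nat.Partrec.Code.primrec_evaln.to_comp.comp ((hk.pair hc).pair hx)

theorem ComputablePred.eq {α σ : Type*} [Primcodable α] [Primcodable σ] [DecidableEq σ]
    {c d : α → σ} (hc : Computable c) (hd : Computable d) :
    ComputablePred fun a => c a = d a :=
  ⟨inferInstance, (Primrec.eq (α := σ)).decide.to_comp.comp hc hd⟩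

theorem ComputablePred.lt {α : Type*} [Primcodable α]
    {c d : α → ℕ} (hc : Computable c) (hd : Computable d) :
    ComputablePred fun a => c a < d a :=
  ⟨inferInstance, Primrec.nat_lt.decide.to_comp.comp hc hd⟩

theorem ComputablePred.comp {α β : Type*} [Primcodable α] [Primcodable β] {p : β → Prop}
    {s : α → β} (hp : ComputablePred p) (hs : Computable s) : ComputablePred fun a => p (s a) := by
  obtain ⟨d, hp⟩ := hp
  exact ⟨fun a => d (s a), hp.comp hs⟩

/-! ### Open relations -/

/-- The function `f` passes through all points of the list `σ`. -/
def PassesThrough (f : ℕ → ℕ) (σ : List (ℕ × ℕ)) : Prop := ∀ p ∈ σ, f p.1 = p.2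

/-- Effectively open relations: effective unions of basic clopen sets of functions. -/
def IsOpenRel {α : Type} [Primcodable α] (P : α → (ℕ → ℕ) → Prop) : Prop :=
  ∃ ρ : α → ℕ → List (ℕ × ℕ), Computable₂ ρ ∧ ∀ a f, P a f ↔ ∃ t, PassesThrough f (ρ a t)

/-- A list of points through which no function passes. -/
def inconsistentPoints : List (ℕ × ℕ) := [(0, 0), (0, 1)]

theorem not_passesThrough_inconsistentPoints (f : ℕ → ℕ) :
    ¬ PassesThrough f inconsistentPoints := by
  intro h
  have h0 := h (0, 0) (by simp [inconsistentPoints])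
  have h1 := h (0, 1) (by simp [inconsistentPoints])
  simp only at h0 h1
  omega

namespace IsOpenRel

variable {α β : Type} [Primcodable α] [Primcodable β]

theorem of_computablePred {R : α → Prop} (hR : ComputablePred R) :
    IsOpenRel fun a (_ : ℕ → ℕ) => R a := by
  classical
  refine ⟨fun a _ => if R a then [] else inconsistentPoints,
    Computable.ite_pred (hR.comp Computable.fst) (Computable.const _) (Computable.const _), ?_⟩
  intro a f
  by_cases h : R a
  · simp [h, PassesThrough]
  · simp [h, not_passesThrough_inconsistentPoints]

theorem comp_reindex {P : β → (ℕ → ℕ) → Prop} (hP : IsOpenRel P) {s : α → β} {τ : α → ℕ → ℕ}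
    (hs : Computable s) (hτ : Computable₂ τ) :
    IsOpenRel fun a f => P (s a) (fun y => f (τ a y)) := by
  obtain ⟨ρ, hρ, h⟩ := hP
  refine ⟨fun a t => (ρ (s a) t).map fun p => (τ a p.1, p.2), ?_, ?_⟩
  · refine Computable.list_map (g := fun (q : α × ℕ) (p : ℕ × ℕ) => (τ q.1 p.1, p.2))
      (hρ.comp (hs.comp Computable.fst) Computable.snd) ?_
    exact (hτ.comp (Computable.fst.comp Computable.fst)
      (Computable.fst.comp Computable.snd)).pair (Computable.snd.comp Computable.snd)
  · intro a f
    simp only [h, PassesThrough, List.forall_mem_map]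

/-- The value of f is guessed by the first half of t, and adding the guess as a point to pass
through makes only the correct guess count. -/
theorem subst_value {P : α × ℕ → (ℕ → ℕ) → Prop} (hP : IsOpenRel P) {c : α → ℕ}
    (hc : Computable c) : IsOpenRel fun a f => P (a, f (c a)) f := by
  obtain ⟨ρ, hρ, h⟩ := hP
  refine ⟨fun a t => (c a, t.unpair.1) :: ρ (a, t.unpair.1) t.unpair.2, ?_, ?_⟩
  · have h1 : Computable fun q : α × ℕ => q.2.unpair.1 := Computable.snd.unpair_fst
    refine Computable.list_cons.comp ((hc.comp Computable.fst).pair h1) ?_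
    exact hρ.comp (Computable.fst.pair h1) Computable.snd.unpair_snd
  · intro a f
    simp only [h]
    constructor
    · rintro ⟨t, ht⟩
      refine ⟨Nat.pair (f (c a)) t, ?_⟩
      simpa [PassesThrough] using ht
    · rintro ⟨t, ht⟩
      have h1 : f (c a) = t.unpair.1 := ht _ List.mem_cons_self
      rw [h1]
      exact ⟨_, fun p hp => ht p (List.mem_cons_of_mem _ hp)⟩

theorem inter {P Q : α → (ℕ → ℕ) → Prop} (hP : IsOpenRel P) (hQ : IsOpenRel Q) :
    IsOpenRel fun a f => P a f ∧ Q a f := by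
  obtain ⟨ρ, hρ, h⟩ := hP
  obtain ⟨ρ', hρ', h'⟩ := hQ
  refine ⟨fun a t => ρ a t.unpair.1 ++ ρ' a t.unpair.2, ?_, ?_⟩
  · exact Computable.list_append.comp
      (hρ.comp Computable.fst Computable.snd.unpair_fst)
      (hρ'.comp Computable.fst Computable.snd.unpair_snd)
  · intro a f
    simp only [h, h']
    constructor
    · rintro ⟨⟨t, ht⟩, t', ht'⟩
      refine ⟨Nat.pair t t', fun p hp => ?_⟩
      rw [Nat.unpair_pair, List.mem_append] at hp
      exact hp.elim (ht p) (ht' p)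
    · rintro ⟨t, ht⟩
      exact ⟨⟨_, fun p hp => ht p (List.mem_append_left _ hp)⟩,
        _, fun p hp => ht p (List.mem_append_right _ hp)⟩

theorem exNat {P : α × ℕ → (ℕ → ℕ) → Prop} (hP : IsOpenRel P) :
    IsOpenRel fun a f => ∃ y, P (a, y) f := by
  obtain ⟨ρ, hρ, h⟩ := hP
  refine ⟨fun a t => ρ (a, t.unpair.1) t.unpair.2, ?_, ?_⟩
  · exact hρ.comp (Computable.fst.pair Computable.snd.unpair_fst) Computable.snd.unpair_snd
  · intro a f
    simp only [h]
    constructor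
    · rintro ⟨y, t, ht⟩
      exact ⟨Nat.pair y t, by simpa using ht⟩
    · rintro ⟨t, ht⟩
      exact ⟨_, _, ht⟩

theorem union {P Q : α → (ℕ → ℕ) → Prop} (hP : IsOpenRel P) (hQ : IsOpenRel Q) :
    IsOpenRel fun a f => P a f ∨ Q a f := by
  obtain ⟨ρ, hρ, h⟩ := hP
  obtain ⟨ρ', hρ', h'⟩ := hQ
  refine ⟨fun a t => if t.unpair.1 = 0 then ρ a t.unpair.2 else ρ' a t.unpair.2, ?_, ?_⟩
  · exact Computable.ite_pred (ComputablePred.eq Computable.snd.unpair_fst (Computable.const 0))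
      (hρ.comp Computable.fst Computable.snd.unpair_snd)
      (hρ'.comp Computable.fst Computable.snd.unpair_snd)
  · intro a f
    simp only [h, h']
    constructor
    · rintro (⟨t, ht⟩ | ⟨t, ht⟩)
      · exact ⟨Nat.pair 0 t, by simpa using ht⟩
      · exact ⟨Nat.pair 1 t, by simpa using ht⟩
    · rintro ⟨t, ht⟩
      split_ifs at ht
      · exact Or.inl ⟨_, ht⟩
      · exact Or.inr ⟨_, ht⟩

/-- An index is a program for the enumeration of basic sets. It is run with a step bound that is
part of t; a run that has not halted contributes the empty set, through `inconsistentPoints`, so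
partial programs do no harm. -/
theorem exists_universal (α : Type) [Primcodable α] :
    ∃ U : ℕ × α → (ℕ → ℕ) → Prop, IsOpenRel U ∧
      ∀ P : α → (ℕ → ℕ) → Prop, IsOpenRel P → ∃ e, ∀ a f, P a f ↔ U (e, a) f := by
  let ρ : ℕ × α → ℕ → List (ℕ × ℕ) := fun p t =>
    (((Nat.Partrec.Code.evaln t.unpair.1 (Denumerable.ofNat Nat.Partrec.Code p.1)
      (Encodable.encode (p.2, t.unpair.2))).bind fun r =>
        (Encodable.decode r : Option (List (ℕ × ℕ))))).getD inconsistentPoints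
  have hρ : Computable₂ ρ := by
    have h1 : Computable fun q : (ℕ × α) × ℕ => Nat.Partrec.Code.evaln q.2.unpair.1
        (Denumerable.ofNat Nat.Partrec.Code q.1.1) (Encodable.encode (q.1.2, q.2.unpair.2)) := by
      have h2 : Computable fun q : (ℕ × α) × ℕ => Encodable.encode (q.1.2, q.2.unpair.2) :=
        Computable.encode.comp ((Computable.snd.comp Computable.fst).pair
          Computable.snd.unpair_snd)
      have h3 : Computable fun q : (ℕ × α) × ℕ => Denumerable.ofNat Nat.Partrec.Code q.1.1 :=
        (Computable.ofNat _).comp (Computable.fst.comp Computable.fst)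
      exact Computable.evaln Computable.snd.unpair_fst h3 h2
    have h4 : Computable₂ fun (_ : (ℕ × α) × ℕ) (r : ℕ) =>
        (Encodable.decode r : Option (List (ℕ × ℕ))) := Computable.decode.comp Computable.snd
    exact Computable.option_getD (Computable.option_bind h1 h4) (Computable.const _)
  refine ⟨fun p f => ∃ t, PassesThrough f (ρ p t), ⟨ρ, hρ, fun _ _ => Iff.rfl⟩, ?_⟩
  rintro P ⟨ρ', hρ', h⟩
  obtain ⟨c, hc⟩ := Nat.Partrec.Code.exists_code.1 hρ'
  have hc' : ∀ a t, Nat.Partrec.Code.eval c (Encodable.encode (a, t)) =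
      Part.some (Encodable.encode (ρ' a t)) := by
    intro a t
    rw [hc]
    simp
  refine ⟨Encodable.encode c, fun a f => ?_⟩
  rw [h]
  constructor
  · rintro ⟨t, ht⟩
    have h1 : Encodable.encode (ρ' a t) ∈ Nat.Partrec.Code.eval c (Encodable.encode (a, t)) := by
      rw [hc']; exact Part.mem_some _
    obtain ⟨k, hk⟩ := Nat.Partrec.Code.evaln_complete.1 h1
    refine ⟨Nat.pair k t, ?_⟩
    have : ρ (Encodable.encode c, a) (Nat.pair k t) = ρ' a t := by
      simp only [ρ, Nat.unpair_pair, Denumerable.ofNat_encode, Option.mem_def.1 hk]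
      simp
    rwa [this]
  · rintro ⟨t, ht⟩
    refine ⟨t.unpair.2, ?_⟩
    rcases hk : Nat.Partrec.Code.evaln t.unpair.1 c (Encodable.encode (a, t.unpair.2)) with _ | r
    · simp only [ρ, Denumerable.ofNat_encode, hk] at ht
      exact absurd ht (not_passesThrough_inconsistentPoints f)
    · have h1 := Nat.Partrec.Code.evaln_sound (Option.mem_def.2 hk)
      rw [hc', Part.mem_some_iff] at h1
      subst h1
      have h2 : ρ (Encodable.encode c, a) t = ρ' a t.unpair.2 := by
        simp only [ρ, Denumerable.ofNat_encode, hk]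
        simp
      rwa [h2] at ht

end IsOpenRel

/-! ### Projective classes over the effectively open relations -/

/-- The function that codes the two functions `g` and `f`. -/
def mergeFun (g f : ℕ → ℕ) (y : ℕ) : ℕ :=
  if y.unpair.1 = 0 then g y.unpair.2 else f y.unpair.2

@[simp] theorem mergeFun_pair_zero (g f : ℕ → ℕ) (y : ℕ) :
    mergeFun g f (Nat.pair 0 y) = g y := by simp [mergeFun]

@[simp] theorem mergeFun_pair_one (g f : ℕ → ℕ) (y : ℕ) :
    mergeFun g f (Nat.pair 1 y) = f y := by simp [mergeFun]

/-- The reindexing of merged functions that reindexes the two components by `u` and `v`. -/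
def mergeIndex (u v : ℕ → ℕ) (y : ℕ) : ℕ :=
  if y.unpair.1 = 0 then Nat.pair 0 (u y.unpair.2) else Nat.pair 1 (v y.unpair.2)

theorem mergeFun_mergeIndex (g f u v : ℕ → ℕ) :
    (fun y => mergeFun g f (mergeIndex u v y)) =
      mergeFun (fun y => g (u y)) (fun y => f (v y)) := by
  funext y
  by_cases h : y.unpair.1 = 0 <;> simp [h, mergeFun, mergeIndex]

/-- The level `n` of the projective hierarchy that starts with the effectively open relations:
one step takes complements and projects along a function variable. -/
def SigmaClass : ℕ → ∀ {α : Type} [Primcodable α], (α → (ℕ → ℕ) → Prop) → Prop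
  | 0, _, _, P => IsOpenRel P
  | n + 1, α, _, P => ∃ Q : α → (ℕ → ℕ) → Prop, SigmaClass n Q ∧
      ∀ a f, P a f ↔ ∃ g : ℕ → ℕ, ¬ Q a (mergeFun g f)

namespace SigmaClass

variable {α β : Type} [Primcodable α] [Primcodable β] {n : ℕ}

theorem of_iff {P Q : α → (ℕ → ℕ) → Prop} (hP : SigmaClass n P)
    (h : ∀ a f, P a f ↔ Q a f) : SigmaClass n Q := by
  have : P = Q := by funext a f; exact propext (h a f)
  rwa [← this]

theorem exFun_compl {Q : α → (ℕ → ℕ) → Prop} (hQ : SigmaClass n Q) :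
    SigmaClass (n + 1) fun a f => ∃ g : ℕ → ℕ, ¬ Q a (mergeFun g f) :=
  ⟨Q, hQ, fun _ _ => Iff.rfl⟩

theorem computable_mergeIndex {u v : α → ℕ → ℕ} (hu : Computable₂ u) (hv : Computable₂ v) :
    Computable₂ fun a => mergeIndex (u a) (v a) :=
  Computable.ite_pred (ComputablePred.eq Computable.snd.unpair_fst (Computable.const 0))
    ((Computable.const 0).natPair (hu.comp Computable.fst Computable.snd.unpair_snd))
    ((Computable.const 1).natPair (hv.comp Computable.fst Computable.snd.unpair_snd))

theorem comp_reindex {P : β → (ℕ → ℕ) → Prop} (hP : SigmaClass n P) {s : α → β} {τ : α → ℕ → ℕ}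
    (hs : Computable s) (hτ : Computable₂ τ) :
    SigmaClass n fun a f => P (s a) (fun y => f (τ a y)) := by
  induction n generalizing P s τ α β with
  | zero => exact IsOpenRel.comp_reindex hP hs hτ
  | succ n ih =>
    obtain ⟨Q, hQ, h⟩ := hP
    refine (exFun_compl (ih hQ hs (computable_mergeIndex
      (u := fun _ y => y) Computable.snd hτ))).of_iff fun a f => ?_
    rw [h]
    simp only [mergeFun_mergeIndex]

theorem comp {P : β → (ℕ → ℕ) → Prop} (hP : SigmaClass n P) {s : α → β} (hs : Computable s) :
    SigmaClass n fun a f => P (s a) f :=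
  hP.comp_reindex (τ := fun _ y => y) hs Computable.snd

theorem subst_value {P : α × ℕ → (ℕ → ℕ) → Prop} (hP : SigmaClass n P) {c : α → ℕ}
    (hc : Computable c) : SigmaClass n fun a f => P (a, f (c a)) f := by
  induction n generalizing P c with
  | zero => exact IsOpenRel.subst_value hP hc
  | succ n ih =>
    obtain ⟨Q, hQ, h⟩ := hP
    refine (exFun_compl (ih hQ ((Computable.const 1).natPair hc))).of_iff fun a f => ?_
    rw [h]
    simp only [mergeFun_pair_one]

theorem exNat {P : α × ℕ → (ℕ → ℕ) → Prop} (hP : SigmaClass n P) :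
    SigmaClass n fun a f => ∃ y, P (a, y) f := by
  cases n with
  | zero => exact IsOpenRel.exNat hP
  | succ n =>
    obtain ⟨Q, hQ, h⟩ := hP
    -- One function carries both witnesses: its value at 0 is the number y, and its shift is the
    -- function witness for y.
    have h1 := hQ.comp_reindex (α := α × ℕ) Computable.id (computable_mergeIndex
      (u := fun _ y => y + 1) (v := fun _ y => y)
      (Computable.succ.comp Computable.snd) Computable.snd)
    refine (exFun_compl (h1.subst_value (c := fun _ => Nat.pair 0 0)
      (Computable.const _))).of_iff fun a f => ?_
    simp only [h, mergeFun_mergeIndex, mergeFun_pair_zero, id]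
    constructor
    · rintro ⟨g, hg⟩
      exact ⟨_, _, hg⟩
    · rintro ⟨y, g, hg⟩
      exact ⟨fun i => Nat.casesOn i y g, hg⟩

/-- Each level is built from complements of the previous one, so De Morgan swaps the two claims and
they must be proved together. -/
theorem inter_union {P P' : α → (ℕ → ℕ) → Prop} (hP : SigmaClass n P) (hP' : SigmaClass n P') :
    (SigmaClass n fun a f => P a f ∧ P' a f) ∧ SigmaClass n fun a f => P a f ∨ P' a f := by
  induction n generalizing P P' with
  | zero => exact ⟨IsOpenRel.inter hP hP', IsOpenRel.union hP hP'⟩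
  | succ n ih =>
    obtain ⟨Q, hQ, h⟩ := hP
    obtain ⟨Q', hQ', h'⟩ := hP'
    have hr (i : ℕ) : Computable₂ fun (_ : α) y => Nat.pair i y :=
      (Computable.const i).natPair Computable.snd
    have hv : Computable₂ fun (_ : α) (y : ℕ) => y := Computable.snd
    constructor
    · refine (exFun_compl (ih
        (hQ.comp_reindex Computable.id (computable_mergeIndex (hr 0) hv))
        (hQ'.comp_reindex Computable.id (computable_mergeIndex (hr 1) hv))).2).of_iff
        fun a f => ?_
      simp only [h, h', mergeFun_mergeIndex, id, not_or]
      constructor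
      · rintro ⟨g, hg, hg'⟩
        exact ⟨⟨_, hg⟩, _, hg'⟩
      · rintro ⟨⟨g, hg⟩, g', hg'⟩
        exact ⟨mergeFun g g', by simpa using hg, by simpa using hg'⟩
    · refine (exFun_compl (ih hQ hQ').1).of_iff fun a f => ?_
      rw [h, h', ← exists_or]
      simp only [not_and_or]

theorem inter {P P' : α → (ℕ → ℕ) → Prop} (hP : SigmaClass n P) (hP' : SigmaClass n P') :
    SigmaClass n fun a f => P a f ∧ P' a f := (inter_union hP hP').1

theorem union {P P' : α → (ℕ → ℕ) → Prop} (hP : SigmaClass n P) (hP' : SigmaClass n P') :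
    SigmaClass n fun a f => P a f ∨ P' a f := (inter_union hP hP').2

/-- By countable choice the witnesses for all y are the columns of a single function; the remaining
number quantifier is absorbed by the matrix. -/
theorem allNat {P : α × ℕ → (ℕ → ℕ) → Prop} (hP : SigmaClass (n + 1) P) :
    SigmaClass (n + 1) fun a f => ∀ y, P (a, y) f := by
  obtain ⟨Q, hQ, h⟩ := hP
  have hu : Computable₂ fun (q : α × ℕ) (y : ℕ) => Nat.pair q.2 y :=
    (Computable.snd.comp Computable.fst).natPair Computable.snd
  have hv : Computable₂ fun (_ : α × ℕ) (y : ℕ) => y := Computable.snd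
  have h1 := hQ.comp_reindex Computable.id (computable_mergeIndex hu hv)
  refine (exFun_compl h1.exNat).of_iff fun a f => ?_
  simp only [h, mergeFun_mergeIndex, id, not_exists]
  constructor
  · rintro ⟨g, hg⟩ y
    exact ⟨_, hg y⟩
  · intro hg
    choose g hg using hg
    exact ⟨fun z => g z.unpair.1 z.unpair.2, fun y => by simpa using hg y⟩

theorem exFun {P : α → (ℕ → ℕ) → Prop} (hP : SigmaClass (n + 1) P) :
    SigmaClass (n + 1) fun a f => ∃ g : ℕ → ℕ, P a (mergeFun g f) := by
  obtain ⟨Q, hQ, h⟩ := hP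
  have hr (i : ℕ) : Computable₂ fun (_ : α) y => Nat.pair i y :=
    (Computable.const i).natPair Computable.snd
  -- The reindexing unpacks one function into the two quantified ones, turning a merge of two
  -- functions into a nested merge of three.
  let w : ℕ → ℕ := fun y => if y.unpair.1 = 0 then Nat.pair 0 (Nat.pair 0 y.unpair.2) else
    if y.unpair.2.unpair.1 = 0 then Nat.pair 0 (Nat.pair 1 y.unpair.2.unpair.2)
    else Nat.pair 1 y.unpair.2.unpair.2
  have hw : Computable w := by
    have h1 := Computable.id.unpair_snd
    exact Computable.ite_pred (ComputablePred.eq Computable.id.unpair_fst (Computable.const 0))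
      ((Computable.const 0).natPair ((Computable.const 0).natPair h1))
      (Computable.ite_pred (ComputablePred.eq h1.unpair_fst (Computable.const 0))
        ((Computable.const 0).natPair ((Computable.const 1).natPair h1.unpair_snd))
        ((Computable.const 1).natPair h1.unpair_snd))
  have h2 (g f : ℕ → ℕ) : (fun y => mergeFun g f (w y)) =
      mergeFun (fun y => g (Nat.pair 0 y)) (mergeFun (fun y => g (Nat.pair 1 y)) f) := by
    funext y
    by_cases h3 : y.unpair.1 = 0
    · simp [w, h3, mergeFun]
    · by_cases h4 : y.unpair.2.unpair.1 = 0 <;> simp [w, h3, h4, mergeFun]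
  refine (exFun_compl (hQ.comp_reindex (α := α) (τ := fun _ y => w y) Computable.id
    (hw.comp Computable.snd))).of_iff fun a f => ?_
  simp only [h, h2, id]
  constructor
  · rintro ⟨g, hg⟩
    exact ⟨_, _, hg⟩
  · rintro ⟨g, g', hg⟩
    exact ⟨mergeFun g' g, by simpa using hg⟩

theorem compl_succ {P : α → (ℕ → ℕ) → Prop} (hP : SigmaClass n P) :
    SigmaClass (n + 1) fun a f => ¬ P a f := by
  refine (exFun_compl (hP.comp_reindex (α := α) (τ := fun _ y => Nat.pair 1 y) Computable.id
    ((Computable.const 1).natPair Computable.snd))).of_iff fun a f => ?_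
  simp

theorem of_computablePred_one {R : α → Prop} (hR : ComputablePred R) :
    SigmaClass 1 fun a (_ : ℕ → ℕ) => R a := by
  have h : SigmaClass 0 fun a (_ : ℕ → ℕ) => ¬ R a := IsOpenRel.of_computablePred hR.not
  exact h.compl_succ.of_iff fun a f => not_not

theorem value_eq_one {c d : α → ℕ} (hc : Computable c) (hd : Computable d) :
    (SigmaClass 1 fun a f => f (c a) = d a) ∧ SigmaClass 1 fun a f => ¬ f (c a) = d a := by
  have h : ComputablePred fun q : α × ℕ => q.2 = d q.1 :=
    ComputablePred.eq Computable.snd (hd.comp Computable.fst)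
  exact ⟨(of_computablePred_one h).subst_value hc, (of_computablePred_one h.not).subst_value hc⟩

/-- Passing through a finite list is a universal number quantifier over its positions, and level 1
is closed under number quantifiers. -/
theorem one_of_zero {P : α → (ℕ → ℕ) → Prop} (hP : SigmaClass 0 P) : SigmaClass 1 P := by
  obtain ⟨ρ, hρ, h⟩ := hP
  have hl : Computable fun q : (α × ℕ) × ℕ => ρ q.1.1 q.1.2 :=
    hρ.comp (Computable.fst.comp Computable.fst) (Computable.snd.comp Computable.fst)
  have hp := hl.list_getD Computable.snd (0, 0)
  have h1 := (of_computablePred_one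
    (ComputablePred.lt Computable.snd (Computable.list_length.comp hl)).not).union
    (value_eq_one (Computable.fst.comp hp) (Computable.snd.comp hp)).1
  refine h1.allNat.exNat.of_iff fun a f => ?_
  rw [h]
  refine exists_congr fun t => ?_
  constructor
  · intro h2 p hp
    obtain ⟨i, hi, rfl⟩ := List.mem_iff_getElem.1 hp
    simpa [hi] using h2 i
  · intro h2 i
    by_cases hi : i < (ρ a t).length
    · right
      simpa [hi] using h2 _ (List.getElem_mem hi)
    · exact Or.inl hi

theorem succ {P : α → (ℕ → ℕ) → Prop} (hP : SigmaClass n P) : SigmaClass (n + 1) P := by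
  induction n generalizing P with
  | zero => exact hP.one_of_zero
  | succ n ih =>
    obtain ⟨Q, hQ, h⟩ := hP
    exact ⟨Q, ih hQ, h⟩

theorem of_computablePred {R : α → Prop} (hR : ComputablePred R) :
    SigmaClass n fun a (_ : ℕ → ℕ) => R a := by
  induction n with
  | zero => exact IsOpenRel.of_computablePred hR
  | succ n ih => exact ih.succ

theorem exists_universal (n : ℕ) (α : Type) [Primcodable α] :
    ∃ U : ℕ × α → (ℕ → ℕ) → Prop, SigmaClass n U ∧
      ∀ P : α → (ℕ → ℕ) → Prop, SigmaClass n P → ∃ e, ∀ a f, P a f ↔ U (e, a) f := by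
  induction n with
  | zero => exact IsOpenRel.exists_universal α
  | succ n ih =>
    obtain ⟨U, hU, h⟩ := ih
    refine ⟨_, exFun_compl hU, ?_⟩
    rintro P ⟨Q, hQ, hP⟩
    obtain ⟨e, he⟩ := h Q hQ
    exact ⟨e, fun a f => by simp only [hP, he]⟩

/-- Quantification over a coded type in place of `ℕ`. -/
theorem exists_decode [Inhabited β] {P : α × β → (ℕ → ℕ) → Prop} (hP : SigmaClass n P) :
    SigmaClass n fun a f => ∃ b, P (a, b) f := by
  have h1 : Computable fun q : α × ℕ =>
      (q.1, ((Encodable.decode q.2 : Option β)).getD default) :=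
    Computable.fst.pair
      (Computable.option_getD (Computable.decode.comp Computable.snd) (Computable.const _))
  refine (hP.comp h1).exNat.of_iff fun a f => ?_
  constructor
  · rintro ⟨y, hy⟩
    exact ⟨_, hy⟩
  · rintro ⟨b, hb⟩
    exact ⟨Encodable.encode b, by simpa using hb⟩

end SigmaClass

/-! ### Comparison with the analytical hierarchy -/

/-- The functions coded by a single function. -/
def splitFun : (m : ℕ) → (ℕ → ℕ) → Fin m → ℕ → ℕ
  | 0, _ => Fin.elim0
  | m + 1, h => Fin.cons (fun y => h (Nat.pair 0 y)) (splitFun m fun y => h (Nat.pair 1 y))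

/-- A single function that codes finitely many functions. -/
def joinFun : (m : ℕ) → (Fin m → ℕ → ℕ) → ℕ → ℕ
  | 0, _ => fun _ => 0
  | m + 1, f => mergeFun (f 0) (joinFun m (Fin.tail f))

theorem splitFun_mergeFun (m : ℕ) (g h : ℕ → ℕ) :
    splitFun (m + 1) (mergeFun g h) = Fin.cons g (splitFun m h) := by
  simp [splitFun]

theorem joinFun_cons (m : ℕ) (g : ℕ → ℕ) (f : Fin m → ℕ → ℕ) :
    joinFun (m + 1) (Fin.cons g f) = mergeFun g (joinFun m f) := by
  simp [joinFun]

theorem exists_splitFun_eq {m : ℕ} (j : Fin m) :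
    ∃ w : ℕ → ℕ, Computable w ∧ ∀ h y, splitFun m h j y = h (w y) := by
  induction m with
  | zero => exact j.elim0
  | succ m ih =>
    refine Fin.cases ?_ (fun j => ?_) j
    · exact ⟨fun y => Nat.pair 0 y, (Computable.const 0).natPair Computable.id, fun h y => rfl⟩
    · obtain ⟨w, hw, h⟩ := ih j
      exact ⟨fun y => Nat.pair 1 (w y), (Computable.const 1).natPair hw, fun h' y => by
        simp [splitFun, h]⟩

/-- Carrying the complement along makes the induction pass through negation; closure under both
number quantifiers handles the rest. -/
theorem IsArithmetical.sigmaClass_one {k m : ℕ} {P : ArithRel k m} (hP : IsArithmetical P) :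
    SigmaClass 1 (fun x h => P x (splitFun m h)) ∧
      SigmaClass 1 fun x h => ¬ P x (splitFun m h) := by
  induction hP with
  | computable R hR =>
    exact ⟨SigmaClass.of_computablePred hR, SigmaClass.of_computablePred hR.not⟩
  | app j a b =>
    obtain ⟨w, hw, h⟩ := exists_splitFun_eq j
    simp only [h]
    exact SigmaClass.value_eq_one (hw.comp (Computable.id.fin_apply a))
      (Computable.id.fin_apply b)
  | compl _ ih => exact ⟨ih.2, by simpa only [not_not] using ih.1⟩
  | inter _ _ ih ih' =>
    refine ⟨ih.1.inter ih'.1, ?_⟩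
    simp only [not_and_or]
    exact ih.2.union ih'.2
  | @exNat k P _ ih =>
    have hc : Computable fun q : (Fin k → ℕ) × ℕ => (Fin.cons q.2 q.1 : Fin (k + 1) → ℕ) :=
      Computable.snd.fin_cons Computable.fst
    refine ⟨(ih.1.comp hc).exNat, ?_⟩
    simp only [not_exists]
    exact (ih.2.comp hc).allNat

theorem IsSigmaOne.sigmaClass {n k m : ℕ} {P : ArithRel k m} (hP : IsSigmaOne (n + 1) P) :
    SigmaClass (n + 1) fun x h => P x (splitFun m h) := by
  induction n generalizing m with
  | zero =>
    obtain ⟨Q, hQ, h⟩ := hP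
    have h1 := (IsArithmetical.sigmaClass_one hQ).2
    -- The arithmetical matrix is itself at level 1, so its function quantifier is contracted with
    -- the outer one.
    refine h1.exFun.of_iff fun a f => ?_
    simp only [splitFun_mergeFun, h, not_not]
  | succ n ih =>
    obtain ⟨Q, hQ, h⟩ := hP
    refine (SigmaClass.exFun_compl (ih hQ)).of_iff fun a f => ?_
    simp only [splitFun_mergeFun, h, not_not]

namespace IsArithmetical

variable {k m : ℕ}

theorem union {P Q : ArithRel k m} (hP : IsArithmetical P) (hQ : IsArithmetical Q) :
    IsArithmetical fun x f => P x f ∨ Q x f := by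
  have h := (hP.compl.inter hQ.compl).compl
  simpa only [not_and_or, not_not] using h

theorem allNat {P : ArithRel (k + 1) m} (hP : IsArithmetical P) :
    IsArithmetical fun x f => ∀ y : ℕ, P (Fin.cons y x) f := by
  have h := hP.compl.exNat.compl
  simpa only [not_exists, not_not] using h

theorem subst {P : ArithRel (k + 1) m} (hP : IsArithmetical P) {c : (Fin k → ℕ) → ℕ}
    (hc : Computable c) : IsArithmetical fun x f => P (Fin.cons (c x) x) f := by
  have h1 : ComputablePred fun x : Fin (k + 1) → ℕ => x 0 = c (fun i => x i.succ) :=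
    ComputablePred.eq (Computable.id.fin_apply 0)
      (hc.comp (Computable.fin_tuple fun i => Computable.id.fin_apply i.succ))
  have h := ((IsArithmetical.computable (m := m) _ h1).inter hP).exNat
  simpa using h

theorem tail_fun {P : ArithRel k m} (hP : IsArithmetical P) :
    IsArithmetical fun x (f : Fin (m + 1) → ℕ → ℕ) => P x (Fin.tail f) := by
  induction hP with
  | computable R hR => exact .computable R hR
  | app j a b => exact .app j.succ a b
  | compl _ ih => exact ih.compl
  | inter _ _ ih ih' => exact ih.inter ih'
  | exNat _ ih => exact ih.exNat

theorem joinFun_eq (a b : Fin k) :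
    IsArithmetical fun x (f : Fin m → ℕ → ℕ) => joinFun m f (x a) = x b := by
  induction m generalizing k with
  | zero =>
    exact .computable _ (ComputablePred.eq (Computable.const 0) (Computable.id.fin_apply b))
  | succ m ih =>
    have ha : Computable fun x : Fin k → ℕ => x a := Computable.id.fin_apply a
    have h0 : ComputablePred fun x : Fin k → ℕ => (x a).unpair.1 = 0 :=
      ComputablePred.eq ha.unpair_fst (Computable.const 0)
    have h1 := ((IsArithmetical.computable (m := m + 1) _ h0).inter
      ((IsArithmetical.app 0 0 b.succ).subst ha.unpair_snd)).union
      ((IsArithmetical.computable _ h0.not).inter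
        ((ih 0 b.succ).tail_fun.subst ha.unpair_snd))
    convert h1 using 3 with x f
    by_cases h : (x a).unpair.1 = 0 <;> simp [joinFun, mergeFun, h]

theorem of_isOpenRel {P : (Fin k → ℕ) → (ℕ → ℕ) → Prop} (hP : IsOpenRel P) (m : ℕ) :
    IsArithmetical fun x (f : Fin m → ℕ → ℕ) => P x (joinFun m f) := by
  obtain ⟨ρ, hρ, h⟩ := hP
  let l : (Fin (k + 2) → ℕ) → List (ℕ × ℕ) := fun x => ρ (fun i => x i.succ.succ) (x 1)
  have hl : Computable l :=
    hρ.comp (Computable.fin_tuple fun i => Computable.id.fin_apply i.succ.succ)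
      (Computable.id.fin_apply 1)
  have hp : Computable fun x => (l x).getD (x 0) (0, 0) :=
    hl.list_getD (Computable.id.fin_apply 0) (0, 0)
  have h1 : ComputablePred fun x => x 0 < (l x).length :=
    ComputablePred.lt (Computable.id.fin_apply 0) (Computable.list_length.comp hl)
  have h2 : Computable fun x : Fin (k + 3) → ℕ =>
      ((l fun i => x i.succ).getD (x 1) (0, 0)).2 :=
    Computable.snd.comp (hp.comp (Computable.fin_tuple fun i => Computable.id.fin_apply i.succ))
  -- Before the two substitutions the leading variables are value, argument, position i and index t,
  -- in this order.
  have h3 := ((IsArithmetical.computable (m := m) _ h1.not).union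
    (((joinFun_eq (1 : Fin (k + 4)) 0).subst h2).subst (Computable.fst.comp hp))).allNat.exNat
  convert h3 using 3 with x f
  rw [h]
  refine exists_congr fun t => ?_
  constructor
  · intro h4 i
    by_cases hi : i < (ρ x t).length
    · right
      have h5 := h4 _ (List.getElem_mem hi)
      simpa [l, hi] using h5
    · left
      simpa [l] using hi
  · intro h4 p hp
    obtain ⟨i, hi, rfl⟩ := List.mem_iff_getElem.1 hp
    simpa [l, hi] using h4 i

end IsArithmetical

theorem SigmaClass.isSigmaOne {n k : ℕ} {P : (Fin k → ℕ) → (ℕ → ℕ) → Prop}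
    (hP : SigmaClass n P) (m : ℕ) :
    IsSigmaOne n fun x (f : Fin m → ℕ → ℕ) => P x (joinFun m f) := by
  induction n generalizing P m with
  | zero => exact IsArithmetical.of_isOpenRel hP m
  | succ n ih =>
    obtain ⟨Q, hQ, h⟩ := hP
    refine ⟨fun x f => ¬ Q x (joinFun (m + 1) f), ?_, ?_⟩
    · simpa only [not_not] using ih hQ (m + 1)
    · intro x f
      simp only [h, joinFun_cons]

theorem isSigmaOne_iff_sigmaClass {n : ℕ} {r : ℕ → ℕ → Prop} :
    IsSigmaOne (n + 1) (k := 2) (m := 0) (fun x _ => r (x 0) (x 1)) ↔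
      SigmaClass (n + 1) fun (q : ℕ × ℕ) (_ : ℕ → ℕ) => r q.1 q.2 := by
  constructor
  · intro h
    have hc : Computable fun q : ℕ × ℕ => (![q.1, q.2] : Fin 2 → ℕ) :=
      Computable.fst.fin_cons (Computable.snd.fin_cons (Computable.const _))
    exact (IsSigmaOne.sigmaClass (k := 2) h).comp hc
  · intro h
    exact (h.comp ((Computable.id.fin_apply (0 : Fin 2)).pair
      (Computable.id.fin_apply (1 : Fin 2)))).isSigmaOne 0

/-! ### The sizes of the classes of an equivalence structure -/

theorem PrimrecRel.forall_lt_param {β : Type*} [Primcodable β] {R : ℕ → β → Prop}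
    (hR : PrimrecRel R) : PrimrecRel fun n b => ∀ x < n, R x b :=
  (hR.forall_mem_list.comp (Primrec.list_range.comp Primrec.fst) Primrec.snd).of_eq (by simp)

theorem PrimrecPred.list_nodup : PrimrecPred (List.Nodup : List ℕ → Prop) := by
  have h1 : PrimrecRel fun (i : ℕ) (q : ℕ × List ℕ) => q.2[i]? ≠ q.2[q.1]? :=
    (Primrec.eq.comp
      (Primrec.list_getElem?.comp (Primrec.snd.comp Primrec.snd) Primrec.fst)
      (Primrec.list_getElem?.comp (Primrec.snd.comp Primrec.snd)
        (Primrec.fst.comp Primrec.snd))).not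
  have h2 : PrimrecRel fun (j : ℕ) (l : List ℕ) => ∀ i < j, l[i]? ≠ l[j]? :=
    h1.forall_lt_param.comp Primrec.fst Primrec.id
  refine (h2.forall_lt_param.comp Primrec.list_length Primrec.id).of_eq fun l => ?_
  rw [List.nodup_iff_getElem?_ne_getElem?]
  exact ⟨fun h i j hij hj => h j hj i hij, fun h j hj i hij => h i j hij hj⟩

theorem PrimrecRel.mem_list : PrimrecRel fun (l : List ℕ) (y : ℕ) => y ∈ l :=
  (Primrec.eq (α := ℕ)).exists_mem_list.of_eq fun l y => by simp

/-- The distinct entries of the list `l` form exactly the class of `x`. -/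
def Setoid.IsClassList (S : Setoid ℕ) (l : List ℕ) (x : ℕ) : Prop :=
  l.Nodup ∧ ∀ y, y ∈ l ↔ S.r x y

/-- The equivalence structure has a class with exactly `k` elements. -/
def Setoid.HasClassOfSize (S : Setoid ℕ) (k : ℕ) : Prop :=
  ∃ q : List ℕ × ℕ, q.1.length = k ∧ S.IsClassList q.1 q.2

theorem Setoid.IsIsomorphic.hasClassOfSize_iff {S R : Setoid ℕ} (h : S.IsIsomorphic R) (k : ℕ) :
    S.HasClassOfSize k ↔ R.HasClassOfSize k := by
  have key : ∀ {S R : Setoid ℕ}, S.r ≃r R.r → S.HasClassOfSize k → R.HasClassOfSize k := by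
    rintro S R e ⟨⟨l, x⟩, hl, hn, hx⟩
    refine ⟨(l.map e, e x), by simpa using hl, hn.map e.injective, fun y => ?_⟩
    obtain ⟨y, rfl⟩ := e.surjective y
    rw [List.mem_map_of_injective e.injective, e.map_rel_iff]
    exact hx y
  obtain ⟨e⟩ := h
  exact ⟨key e, key e.symm⟩

/-- The number `Nat.pair k i` with `i < k + 2` lies in the block `k`, and the elements of this
block are equivalent if `k ∈ A`; all other elements form singletons. -/
def blockSetoid (A : ℕ → Prop) : Setoid ℕ where
  r x y := x = y ∨ A x.unpair.1 ∧ x.unpair.1 = y.unpair.1 ∧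
    x.unpair.2 < x.unpair.1 + 2 ∧ y.unpair.2 < x.unpair.1 + 2
  iseqv :=
    { refl := fun x => Or.inl rfl
      symm := by
        rintro x y (rfl | ⟨h1, h2, h3, h4⟩)
        · exact Or.inl rfl
        · exact Or.inr ⟨h2 ▸ h1, h2.symm, h2 ▸ h4, h2 ▸ h3⟩
      trans := by
        rintro x y z (rfl | ⟨h1, h2, h3, h4⟩) (rfl | ⟨h5, h6, h7, h8⟩)
        · exact Or.inl rfl
        · exact Or.inr ⟨h5, h6, h7, h8⟩
        · exact Or.inr ⟨h1, h2, h3, h4⟩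
        · exact Or.inr ⟨h1, h2.trans h6, h3, h2 ▸ h8⟩ }

/-- Distinct blocks have distinct sizes, and the offset 2 keeps these apart from the singletons, so
the size identifies the block. -/
theorem blockSetoid_hasClassOfSize {A : ℕ → Prop} {k : ℕ} :
    (blockSetoid A).HasClassOfSize (k + 2) ↔ A k := by
  have hmem (j y : ℕ) : y ∈ (List.range (j + 2)).map (Nat.pair j) ↔
      y.unpair.1 = j ∧ y.unpair.2 < j + 2 := by
    rw [List.mem_map]
    constructor
    · rintro ⟨i, hi, rfl⟩
      simpa using hi
    · rintro ⟨rfl, h⟩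
      exact ⟨y.unpair.2, by simpa using h, by simp⟩
  have hnodup (j : ℕ) : ((List.range (j + 2)).map (Nat.pair j)).Nodup :=
    List.nodup_range.map fun a b h => (Nat.pair_eq_pair.1 h).2
  constructor
  · rintro ⟨⟨l, x⟩, hl, hn, hx⟩
    by_cases h : A x.unpair.1 ∧ x.unpair.2 < x.unpair.1 + 2
    · have hp : l.Perm ((List.range (x.unpair.1 + 2)).map (Nat.pair x.unpair.1)) := by
        rw [List.perm_ext_iff_of_nodup hn (hnodup _)]
        intro y
        rw [hx, hmem]
        constructor
        · rintro (rfl | ⟨h1, h2, h3, h4⟩)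
          · exact ⟨rfl, h.2⟩
          · exact ⟨h2.symm, h4⟩
        · rintro ⟨h1, h2⟩
          exact Or.inr ⟨h.1, h1.symm, h.2, h2⟩
      have h1 := hp.length_eq
      simp only [List.length_map, List.length_range] at h1 hl
      have h2 : k = x.unpair.1 := by omega
      exact h2 ▸ h.1
    · have hsub : l ⊆ [x] := by
        intro y hy
        rcases (hx y).1 hy with h1 | ⟨h1, -, h3, -⟩
        · exact List.mem_singleton.2 h1.symm
        · exact absurd ⟨h1, h3⟩ h
      have h1 := (hn.subperm hsub).length_le
      simp only [List.length_singleton] at h1 hl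
      omega
  · intro hA
    refine ⟨((List.range (k + 2)).map (Nat.pair k), Nat.pair k 0), by simp, hnodup k,
      fun y => ?_⟩
    rw [hmem]
    constructor
    · rintro ⟨rfl, h⟩
      exact Or.inr (by simpa using ⟨hA, h⟩)
    · rintro (rfl | ⟨h1, h2, h3, h4⟩)
      · simp
      · simp only [Nat.unpair_pair] at h2 h4
        exact ⟨h2.symm, h4⟩

/-! ### Complexity of block structures and of the set of class sizes -/

namespace SigmaClass

variable {n : ℕ} {S : Setoid ℕ}

theorem blockSetoid_rel {A : ℕ → Prop} (hA : SigmaClass n fun x (_ : ℕ → ℕ) => A x) :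
    SigmaClass n fun (q : ℕ × ℕ) (_ : ℕ → ℕ) => (blockSetoid A).r q.1 q.2 := by
  have h1 : Computable fun q : ℕ × ℕ => q.1.unpair.1 := Computable.fst.unpair_fst
  have h2 : Computable fun q : ℕ × ℕ => q.1.unpair.1 + 2 :=
    Computable.succ.comp (Computable.succ.comp h1)
  exact (of_computablePred (ComputablePred.eq Computable.fst Computable.snd)).union
    ((hA.comp h1).inter ((of_computablePred
      (ComputablePred.eq h1 Computable.snd.unpair_fst)).inter ((of_computablePred
        (ComputablePred.lt Computable.fst.unpair_snd h2)).inter (of_computablePred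
          (ComputablePred.lt Computable.snd.unpair_snd h2)))))

theorem blockSetoid_compl {A : ℕ → Prop} (hA : SigmaClass n fun x (_ : ℕ → ℕ) => ¬ A x) :
    SigmaClass n fun (q : ℕ × ℕ) (_ : ℕ → ℕ) => ¬ (blockSetoid A).r q.1 q.2 := by
  have h1 : Computable fun q : ℕ × ℕ => q.1.unpair.1 := Computable.fst.unpair_fst
  have h2 : Computable fun q : ℕ × ℕ => q.1.unpair.1 + 2 :=
    Computable.succ.comp (Computable.succ.comp h1)
  refine ((of_computablePred (ComputablePred.eq Computable.fst Computable.snd).not).inter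
    ((hA.comp h1).union ((of_computablePred
      (ComputablePred.eq h1 Computable.snd.unpair_fst).not).union ((of_computablePred
        (ComputablePred.lt Computable.fst.unpair_snd h2).not).union (of_computablePred
          (ComputablePred.lt Computable.snd.unpair_snd h2).not))))).of_iff fun q f => ?_
  simp only [← not_or, ← not_and_or]
  rfl

/-- The relation in `k`, `l`, `x` that `l` has `k + 2` entries, all distinct and in the class
of `x`. -/
def InClass (S : Setoid ℕ) (q : ℕ × List ℕ × ℕ) : Prop :=
  (q.2.1.length = q.1 + 2 ∧ q.2.1.Nodup) ∧ ∀ y, y ∈ q.2.1 → S.r q.2.2 y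

/-- The relation in `k`, `l`, `x` that the list `l` contains the class of `x`. -/
def ContainsClass (S : Setoid ℕ) (q : ℕ × List ℕ × ℕ) : Prop :=
  ∀ y, y ∈ q.2.1 ∨ ¬ S.r q.2.2 y

/-- The two conjuncts separate the positive use of the relation from the negative one, so a
one-sided bound on the relation bounds one conjunct and the complement of the other. -/
theorem hasClassOfSize_iff (k : ℕ) :
    S.HasClassOfSize (k + 2) ↔ ∃ b : List ℕ × ℕ, InClass S (k, b) ∧ ContainsClass S (k, b) := by
  refine exists_congr fun b => ?_
  simp only [InClass, ContainsClass, Setoid.IsClassList, iff_def, ← imp_iff_or_not, forall_and]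
  tauto

theorem computablePred_length_nodup : ComputablePred fun q : ℕ × List ℕ × ℕ =>
    q.2.1.length = q.1 + 2 ∧ q.2.1.Nodup := by
  have h1 : Primrec fun q : ℕ × List ℕ × ℕ => q.2.1 := Primrec.fst.comp Primrec.snd
  refine PrimrecPred.computablePred (PrimrecPred.and ?_ (PrimrecPred.list_nodup.comp h1))
  exact Primrec.eq.comp (Primrec.list_length.comp h1)
    (Primrec.succ.comp (Primrec.succ.comp Primrec.fst))

theorem computablePred_mem : ComputablePred fun p : (ℕ × List ℕ × ℕ) × ℕ => p.2 ∈ p.1.2.1 :=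
  PrimrecPred.computablePred (PrimrecRel.mem_list.comp
    (Primrec.fst.comp (Primrec.snd.comp Primrec.fst)) Primrec.snd)

theorem computable_class_elem : Computable fun p : (ℕ × List ℕ × ℕ) × ℕ => (p.1.2.2, p.2) :=
  (Computable.snd.comp (Computable.snd.comp Computable.fst)).pair Computable.snd

theorem inClass (hS : SigmaClass (n + 1) fun (q : ℕ × ℕ) (_ : ℕ → ℕ) => S.r q.1 q.2) :
    SigmaClass (n + 1) fun q (_ : ℕ → ℕ) => InClass S q :=
  (of_computablePred computablePred_length_nodup).inter
    (((of_computablePred computablePred_mem.not).union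
      (hS.comp computable_class_elem)).allNat.of_iff fun _ _ =>
        forall_congr' fun _ => imp_iff_not_or.symm)

theorem inClass_compl (hS : SigmaClass n fun (q : ℕ × ℕ) (_ : ℕ → ℕ) => ¬ S.r q.1 q.2) :
    SigmaClass n fun q (_ : ℕ → ℕ) => ¬ InClass S q := by
  refine ((of_computablePred computablePred_length_nodup.not).union
    ((of_computablePred computablePred_mem).inter
      (hS.comp computable_class_elem)).exNat).of_iff fun q f => ?_
  simp only [InClass, not_and_or, not_forall, exists_prop]

theorem containsClass (hS : SigmaClass (n + 1) fun (q : ℕ × ℕ) (_ : ℕ → ℕ) => ¬ S.r q.1 q.2) :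
    SigmaClass (n + 1) fun q (_ : ℕ → ℕ) => ContainsClass S q :=
  ((of_computablePred computablePred_mem).union (hS.comp computable_class_elem)).allNat

theorem containsClass_compl (hS : SigmaClass n fun (q : ℕ × ℕ) (_ : ℕ → ℕ) => S.r q.1 q.2) :
    SigmaClass n fun q (_ : ℕ → ℕ) => ¬ ContainsClass S q := by
  refine ((of_computablePred computablePred_mem.not).inter
    (hS.comp computable_class_elem)).exNat.of_iff fun q f => ?_
  simp only [ContainsClass, not_forall, not_or, not_not]

theorem forall_decode {α β : Type} [Primcodable α] [Primcodable β] [Inhabited β]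
    {P : α × β → (ℕ → ℕ) → Prop} (hP : SigmaClass (n + 1) P) :
    SigmaClass (n + 1) fun a f => ∀ b, P (a, b) f := by
  have h1 : Computable fun q : α × ℕ =>
      (q.1, ((Encodable.decode q.2 : Option β)).getD default) :=
    Computable.fst.pair
      (Computable.option_getD (Computable.decode.comp Computable.snd) (Computable.const _))
  refine (hP.comp h1).allNat.of_iff fun a f => ?_
  exact ⟨fun h b => by simpa using h (Encodable.encode b), fun h y => h _⟩

/-- Evaluation of a relation at the zero function. -/
theorem apply_zero {P : ℕ → (ℕ → ℕ) → Prop} (hP : SigmaClass (n + 1) P) :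
    SigmaClass (n + 1) fun a (_ : ℕ → ℕ) => P a fun _ => 0 := by
  -- Going to the analytical hierarchy with no function variables and back replaces the parameter by
  -- `joinFun 0`, the zero function.
  have h1 := ((hP.comp (Computable.id.fin_apply (0 : Fin 1))).isSigmaOne 0).sigmaClass
  have h2 : Computable fun a : ℕ => (fun _ => a : Fin 1 → ℕ) :=
    Computable.fin_tuple fun _ => Computable.id
  exact h1.comp h2

theorem hasClassOfSize (hS : SigmaClass (n + 1) fun (q : ℕ × ℕ) (_ : ℕ → ℕ) => S.r q.1 q.2)
    (hS' : SigmaClass (n + 1) fun (q : ℕ × ℕ) (_ : ℕ → ℕ) => ¬ S.r q.1 q.2) :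
    SigmaClass (n + 1) fun k (_ : ℕ → ℕ) => S.HasClassOfSize (k + 2) := by
  simp only [hasClassOfSize_iff]
  exact ((inClass hS).inter (containsClass hS')).exists_decode

theorem hasClassOfSize_compl
    (hS : SigmaClass (n + 1) fun (q : ℕ × ℕ) (_ : ℕ → ℕ) => S.r q.1 q.2)
    (hS' : SigmaClass (n + 1) fun (q : ℕ × ℕ) (_ : ℕ → ℕ) => ¬ S.r q.1 q.2) :
    SigmaClass (n + 1) fun k (_ : ℕ → ℕ) => ¬ S.HasClassOfSize (k + 2) := by
  simp only [hasClassOfSize_iff, not_exists, not_and_or]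
  exact ((inClass_compl hS').union (containsClass_compl hS)).forall_decode

/-! ### Diagonal sets -/

theorem exists_not_compl (n : ℕ) : ∃ A : ℕ → Prop,
    (SigmaClass (n + 1) fun x (_ : ℕ → ℕ) => A x) ∧
      ¬ SigmaClass (n + 1) fun x (_ : ℕ → ℕ) => ¬ A x := by
  obtain ⟨U, hU, h⟩ := exists_universal (n + 1) ℕ
  refine ⟨fun e => U (e, e) fun _ => 0, (hU.comp (Computable.id.pair Computable.id)).apply_zero,
    fun hA => ?_⟩
  obtain ⟨e, he⟩ := h _ hA
  have := he e fun _ => 0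
  tauto

/-- A number e codes indices of a pair P, Q, and membership of e in D negates the form for that pair
at e. Both D and its complement stay at level n + 2, since quantification over b is a number
quantifier. -/
theorem exists_not_exists_inter_compl (n : ℕ) (β : Type) [Primcodable β] [Inhabited β] :
    ∃ D : ℕ → Prop, (SigmaClass (n + 2) fun x (_ : ℕ → ℕ) => D x) ∧
      (SigmaClass (n + 2) fun x (_ : ℕ → ℕ) => ¬ D x) ∧
      ∀ P Q : ℕ × β → Prop, (SigmaClass (n + 1) fun q (_ : ℕ → ℕ) => P q) →
        (SigmaClass (n + 1) fun q (_ : ℕ → ℕ) => Q q) →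
        ¬ ∀ k, D k ↔ ∃ b, P (k, b) ∧ ¬ Q (k, b) := by
  obtain ⟨U, hU, h⟩ := exists_universal (n + 1) (ℕ × β)
  have h1 : SigmaClass (n + 1) fun (q : ℕ × β) f => U (q.1.unpair.1, q) f :=
    hU.comp (Computable.fst.unpair_fst.pair Computable.id)
  have h2 : SigmaClass (n + 1) fun (q : ℕ × β) f => U (q.1.unpair.2, q) f :=
    hU.comp (Computable.fst.unpair_snd.pair Computable.id)
  refine ⟨fun e => ¬ ∃ b, U (e.unpair.1, e, b) (fun _ => 0) ∧ ¬ U (e.unpair.2, e, b) fun _ => 0,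
    ?_, ?_, ?_⟩
  · have h3 := (h1.compl_succ.union h2.succ).forall_decode.apply_zero
    simpa only [not_exists, not_and_or, not_not] using h3
  · have h3 := (h1.succ.inter h2.compl_succ).exists_decode.apply_zero
    simpa only [not_not] using h3
  · intro P Q hP hQ hD
    obtain ⟨e, he⟩ := h _ hP
    obtain ⟨e', he'⟩ := h _ hQ
    have h3 := hD (Nat.pair e e')
    simp only [Nat.unpair_pair, ← he, ← he'] at h3
    exact not_iff_self h3

end SigmaClass

/-! ### The required structures -/

theorem mainTheorem4 (n : ℕ) (hn : 1 ≤ n) :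
    ((∃ S : Setoid ℕ, IsSigmaOne n S.toArithRel ∧
        ∀ R : Setoid ℕ, IsDeltaOne n R.toArithRel → ¬ S.IsIsomorphic R) ∧
      (∃ S : Setoid ℕ, IsPiOne n S.toArithRel ∧
        ∀ R : Setoid ℕ, IsDeltaOne n R.toArithRel → ¬ S.IsIsomorphic R)) ∧
    (∃ S : Setoid ℕ, IsDeltaOne (n + 1) S.toArithRel ∧
      ∀ R : Setoid ℕ, IsSigmaOne n R.toArithRel ∨ IsPiOne n R.toArithRel →
        ¬ S.IsIsomorphic R) := by
  obtain ⟨n, rfl⟩ := Nat.exists_eq_add_of_le' hn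
  obtain ⟨A, hA, hA'⟩ := SigmaClass.exists_not_compl n
  have sigma_iff (n : ℕ) (R : Setoid ℕ) : IsSigmaOne (n + 1) R.toArithRel ↔
      SigmaClass (n + 1) fun (q : ℕ × ℕ) (_ : ℕ → ℕ) => R.r q.1 q.2 :=
    isSigmaOne_iff_sigmaClass (r := R.r)
  have pi_iff (n : ℕ) (R : Setoid ℕ) : IsPiOne (n + 1) R.toArithRel ↔
      SigmaClass (n + 1) fun (q : ℕ × ℕ) (_ : ℕ → ℕ) => ¬ R.r q.1 q.2 :=
    isSigmaOne_iff_sigmaClass (r := fun x y => ¬ R.r x y)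
  refine ⟨⟨⟨blockSetoid A, (sigma_iff _ _).2 (SigmaClass.blockSetoid_rel hA), ?_⟩,
    ⟨blockSetoid fun x => ¬ A x, (pi_iff _ _).2 (SigmaClass.blockSetoid_compl ?_), ?_⟩⟩, ?_⟩
  · rintro R ⟨h1, h2⟩ hR
    have h3 := SigmaClass.hasClassOfSize_compl ((sigma_iff _ _).1 h1) ((pi_iff _ _).1 h2)
    simp only [← hR.hasClassOfSize_iff, blockSetoid_hasClassOfSize] at h3
    exact hA' h3
  · simpa only [not_not] using hA
  · rintro R ⟨h1, h2⟩ hR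
    have h3 := SigmaClass.hasClassOfSize ((sigma_iff _ _).1 h1) ((pi_iff _ _).1 h2)
    simp only [← hR.hasClassOfSize_iff, blockSetoid_hasClassOfSize] at h3
    exact hA' h3
  · obtain ⟨D, hD, hD', h⟩ := SigmaClass.exists_not_exists_inter_compl n (List ℕ × ℕ)
    refine ⟨blockSetoid D, ⟨(sigma_iff _ _).2 (SigmaClass.blockSetoid_rel hD),
      (pi_iff _ _).2 (SigmaClass.blockSetoid_compl hD')⟩, ?_⟩
    rintro R (hR | hR) hiso
    · have h1 := (sigma_iff _ _).1 hR
      -- For R in Σ¹ the positive conjunct serves as P; for R in Π¹ the roles of the conjuncts are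
      -- exchanged.
      refine h _ _ (SigmaClass.inClass h1) (SigmaClass.containsClass_compl h1) fun k => ?_
      rw [← blockSetoid_hasClassOfSize (A := D), hiso.hasClassOfSize_iff, SigmaClass.hasClassOfSize_iff]
      simp only [not_not]
    · have h1 := (pi_iff _ _).1 hR
      refine h _ _ (SigmaClass.containsClass h1) (SigmaClass.inClass_compl h1) fun k => ?_
      rw [← blockSetoid_hasClassOfSize (A := D), hiso.hasClassOfSize_iff, SigmaClass.hasClassOfSize_iff]
      simp only [not_not, and_comm]
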